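/- Theorem. An algebra over $\mathbb C$ is a complex vector space with a bilinear product, not assumed associative or unital. It is bicommutative if $(xy)z=(xz)y$ and $x(yz)=y(xz)$ for all $x,y,z$; it is nilpotent if for some $n\ge 1$ every product of $n$ elements, with any arrangement of brackets, is zero; and it is pure if it does not satisfy the pair of identities $(xy)z=0$ and $x(yz)=0$. Then every $4$-dimensional nilpotent pure bicommutative algebra over $\mathbb C$ is isomorphic to one of the following algebras, and conversely each of them (and so each algebra isomorphic to one of them) is a $4$-dimensional nilpotent pure bicommutative algebra. The algebras are given by a basis $e_1,e_2,e_3,e_4$ and the products of basis vectors shown; products of basis vectors that are not shown are zero, and $\alpha\in\mathbb C$. - $\mathcal B^4_{01}$: $e_1e_1=e_2$, $e_2e_1=e_3$ - $\mathcal B^4_{02}(\alpha)$: $e_1e_1=e_2$, $e_1e_2=e_3$, $e_2e_1=\alpha e_3$ - $\mathcal B^4_{03}$: $e_1e_1=e_2$, $e_1e_2=e_4$, $e_2e_1=e_3$ - $\mathcal B^4_{04}(\alpha)$: $e_1e_1=e_2$, $e_1e_2=e_4$, $e_2e_1=\alpha e_4$, $e_3e_3=e_4$ - $\mathcal B^4_{05}$: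 $e_1e_1=e_2$, $e_1e_2=e_4$, $e_1e_3=e_4$, $e_2e_1=e_4$, $e_3e_3=e_4$ - $\mathcal B^4_{06}(\alpha)$, $\alpha\ne 0$: $e_1e_1=e_2$, $e_1e_2=e_4$, $e_1e_3=e_4$, $e_2e_1=\alpha e_4$ - $\mathcal B^4_{07}$: $e_1e_1=e_2$, $e_2e_1=e_4$, $e_3e_3=e_4$ - $\mathcal B^4_{08}$: $e_1e_1=e_2$, $e_1e_3=e_4$, $e_2e_1=e_4$ - $\mathcal B^4_{09}$: $e_1e_1=e_2$, $e_1e_2=e_4$, $e_3e_1=e_4$ - $\mathcal B^4_{10}$: $e_1e_2=e_3$, $e_1e_3=e_4$, $e_2e_1=e_4$, $e_3e_2=e_4$ - $\mathcal B^4_{11}$: $e_1e_2=e_3$, $e_1e_3=e_4$, $e_3e_2=e_4$ - $\mathcal B^4_{12}$: $e_1e_2=e_3$, $e_1e_1=e_4$, $e_2e_1=e_4$, $e_3e_2=e_4$ - $\mathcal B^4_{13}$: $e_1e_2=e_3$, $e_2e_1=e_4$, $e_3e_2=e_4$ - $\mathcal B^4_{14}$: $e_1e_2=e_3$, $e_1e_3=e_4$,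 $e_2e_1=e_4$, $e_2e_2=e_4$ - $\mathcal B^4_{15}$: $e_1e_2=e_3$, $e_1e_3=e_4$, $e_2e_1=e_4$ - $\mathcal B^4_{16}$: $e_1e_2=e_3$, $e_1e_3=e_4$, $e_2e_2=e_4$ - $\mathcal B^4_{17}$: $e_1e_2=e_3$, $e_1e_3=e_4$ - $\mathcal B^4_{18}$: $e_1e_2=e_3$, $e_1e_1=e_4$, $e_3e_2=e_4$ - $\mathcal B^4_{19}$: $e_1e_2=e_3$, $e_3e_2=e_4$ - $\mathcal B^4_{20}$: $e_1e_1=e_2$, $e_2e_1=e_3$, $e_1e_2=e_4$, $e_3e_1=e_4$ - $\mathcal B^4_{21}$: $e_1e_1=e_2$, $e_2e_1=e_3$, $e_3e_1=e_4$ - $\mathcal B^4_{22}$: $e_1e_1=e_2$, $e_1e_2=e_3$, $e_1e_3=e_4$, $e_2e_1=e_4$ - $\mathcal B^4_{23}$: $e_1e_1=e_2$, $e_1e_2=e_3$, $e_1e_3=e_4$, $e_2e_1=e_3+e_4$, $e_2e_2=e_4$, $e_3e_1=e_4$ - $\mathcal B^4_{24}(\alpha)$: $e_1e_1=e_2$,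 $e_1e_2=e_3$, $e_1e_3=e_4$, $e_2e_1=\alpha e_3$, $e_2e_2=\alpha e_4$, $e_3e_1=\alpha e_4$ -/

import Mathlib

namespace Bicomm

/-! ### Varieties of algebras

An algebra over `ℂ`, not assumed associative or unital, is a type `B` with
`[NonUnitalNonAssocRing B] [Module ℂ B] [IsScalarTower ℂ B B] [SMulCommClass ℂ B B]`;
the last two classes say that the product is `ℂ`-bilinear. -/

/-- Right- and left-commutativity: `(xy)z = (xz)y` and `x(yz) = y(xz)`. -/
def IsBicommutative (B : Type*) [NonUnitalNonAssocRing B] : Prop :=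
  (∀ x y z : B, (x * y) * z = (x * z) * y) ∧ (∀ x y z : B, x * (y * z) = y * (x * z))

/-- `IsProductOf n x` : the element `x` is a product of `n` elements of `B`,
with some arrangement of brackets. -/
inductive IsProductOf {B : Type*} [NonUnitalNonAssocRing B] : ℕ → B → Prop
  | single (x : B) : IsProductOf 1 x
  | mul {m n : ℕ} {x y : B} (hx : IsProductOf m x) (hy : IsProductOf n y) :
      IsProductOf (m + n) (x * y)

/-- A not necessarily associative algebra is nilpotent if for some `n ≥ 1` all products
of `n` elements, with any arrangement of brackets, vanish (`n = 0` has to be excluded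
since there are no products of zero elements). -/
def IsNilpotentAlgebra (B : Type*) [NonUnitalNonAssocRing B] : Prop :=
  ∃ n : ℕ, 1 ≤ n ∧ ∀ x : B, IsProductOf n x → x = 0

/-- The algebra is pure: it does not satisfy the two identities `(xy)z = 0` and
`x(yz) = 0`. -/
def IsPure (B : Type*) [NonUnitalNonAssocRing B] : Prop :=
  ¬ ∀ x y z : B, (x * y) * z = 0 ∧ x * (y * z) = 0

/-- `B` and `C` are isomorphic as `ℂ`-algebras. -/
def AlgIsomorphic (B C : Type*)
    [NonUnitalNonAssocRing B] [Module ℂ B] [NonUnitalNonAssocRing C] [Module ℂ C] : Prop :=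
  ∃ f : B →ₙₐ[ℂ] C, Function.Bijective f

/-! ### Algebras given by a multiplication table -/

/-- A multiplication table on the basis `e₁, e₂, e₃, e₄`: an entry `(p, q, r, c)`
contributes the summand `c eᵣ` to the product `e_p e_q`; the product of two basis vectors
for which there is no entry is zero. -/
abbrev MulTable := List (ℕ × ℕ × ℕ × ℂ)

/-- The coefficient of `e_{k+1}` in `e_{i+1} e_{j+1}` (elements of `Fin 4` start at `0`,
the labels in a multiplication table start at `1`). -/
noncomputable def MulTable.coeff (t : MulTable) (i j k : Fin 4) : ℂ :=
  (t.map fun s =>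
    if s.1 = (i : ℕ) + 1 ∧ s.2.1 = (j : ℕ) + 1 ∧ s.2.2.1 = (k : ℕ) + 1 then s.2.2.2 else 0).sum

/-- The algebra with underlying space `ℂ⁴` and the given multiplication table on its
standard basis. -/
def MulTable.Alg (_t : MulTable) : Type := Fin 4 → ℂ

namespace MulTable

variable (t : MulTable)

noncomputable instance : AddCommGroup t.Alg := inferInstanceAs (AddCommGroup (Fin 4 → ℂ))

noncomputable instance : Module ℂ t.Alg := inferInstanceAs (Module ℂ (Fin 4 → ℂ))

/-- The bilinear extension of the multiplication table. -/
noncomputable instance : Mul t.Alg where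
  mul x y := fun k => ∑ i : Fin 4, ∑ j : Fin 4, x i * y j * t.coeff i j k

variable {t}

theorem mul_apply (x y : t.Alg) (k : Fin 4) :
    (x * y) k = ∑ i : Fin 4, ∑ j : Fin 4, x i * y j * t.coeff i j k := rfl

theorem add_apply (x y : t.Alg) (k : Fin 4) : (x + y) k = x k + y k := rfl

theorem zero_apply (k : Fin 4) : (0 : t.Alg) k = 0 := rfl

theorem smul_apply (a : ℂ) (x : t.Alg) (k : Fin 4) : (a • x) k = a * x k := rfl

variable (t)

noncomputable instance : NonUnitalNonAssocRing t.Alg where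
  __ := (inferInstance : AddCommGroup t.Alg)
  __ := (inferInstance : Mul t.Alg)
  left_distrib x y z := by
    funext k
    simp only [mul_apply, add_apply, mul_add, add_mul, Finset.sum_add_distrib]
  right_distrib x y z := by
    funext k
    simp only [mul_apply, add_apply, add_mul, Finset.sum_add_distrib]
  zero_mul x := by
    funext k
    simp only [mul_apply, zero_apply, zero_mul, Finset.sum_const_zero]
  mul_zero x := by
    funext k
    simp only [mul_apply, zero_apply, mul_zero, zero_mul, Finset.sum_const_zero]

instance : IsScalarTower ℂ t.Alg t.Alg where
  smul_assoc a x y := by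
    funext k
    simp only [smul_eq_mul, mul_apply, smul_apply, Finset.mul_sum, mul_assoc]

instance : SMulCommClass ℂ t.Alg t.Alg where
  smul_comm a x y := by
    funext k
    simp only [smul_eq_mul, mul_apply, smul_apply, Finset.mul_sum]
    refine Finset.sum_congr rfl fun i _ => Finset.sum_congr rfl fun j _ => ?_
    ring

end MulTable

/-! ### The list of algebras -/

/-- The labels of the list: `B⁴₀₁, …, B⁴₂₄`, with the parameter in the families
`B⁴₀₂(α)`, `B⁴₀₄(α)`, `B⁴₀₆(α)` (`α ≠ 0`) and `B⁴₂₄(α)`. -/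
inductive TableA : Type
  | B01
  | B02 (α : ℂ)
  | B03
  | B04 (α : ℂ)
  | B05
  | B06 (α : ℂ) (hα : α ≠ 0)
  | B07
  | B08
  | B09
  | B10
  | B11
  | B12
  | B13
  | B14
  | B15
  | B16
  | B17
  | B18
  | B19
  | B20
  | B21
  | B22
  | B23
  | B24 (α : ℂ)

/-- The multiplication tables of the list; `(p, q, r, c)` stands for the summand `c eᵣ`
of `e_p e_q`. -/
noncomputable def TableA.mulTable : TableA → MulTable
  | .B01 => [(1, 1, 2, 1), (2, 1, 3, 1)]
  | .B02 α => [(1, 1, 2, 1), (1, 2, 3, 1), (2, 1, 3, α)]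
  | .B03 => [(1, 1, 2, 1), (1, 2, 4, 1), (2, 1, 3, 1)]
  | .B04 α => [(1, 1, 2, 1), (1, 2, 4, 1), (2, 1, 4, α), (3, 3, 4, 1)]
  | .B05 => [(1, 1, 2, 1), (1, 2, 4, 1), (1, 3, 4, 1), (2, 1, 4, 1), (3, 3, 4, 1)]
  | .B06 α _ => [(1, 1, 2, 1), (1, 2, 4, 1), (1, 3, 4, 1), (2, 1, 4, α)]
  | .B07 => [(1, 1, 2, 1), (2, 1, 4, 1), (3, 3, 4, 1)]
  | .B08 => [(1, 1, 2, 1), (1, 3, 4, 1), (2, 1, 4, 1)]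
  | .B09 => [(1, 1, 2, 1), (1, 2, 4, 1), (3, 1, 4, 1)]
  | .B10 => [(1, 2, 3, 1), (1, 3, 4, 1), (2, 1, 4, 1), (3, 2, 4, 1)]
  | .B11 => [(1, 2, 3, 1), (1, 3, 4, 1), (3, 2, 4, 1)]
  | .B12 => [(1, 2, 3, 1), (1, 1, 4, 1), (2, 1, 4, 1), (3, 2, 4, 1)]
  | .B13 => [(1, 2, 3, 1), (2, 1, 4, 1), (3, 2, 4, 1)]
  | .B14 => [(1, 2, 3, 1), (1, 3, 4, 1), (2, 1, 4, 1), (2, 2, 4, 1)]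
  | .B15 => [(1, 2, 3, 1), (1, 3, 4, 1), (2, 1, 4, 1)]
  | .B16 => [(1, 2, 3, 1), (1, 3, 4, 1), (2, 2, 4, 1)]
  | .B17 => [(1, 2, 3, 1), (1, 3, 4, 1)]
  | .B18 => [(1, 2, 3, 1), (1, 1, 4, 1), (3, 2, 4, 1)]
  | .B19 => [(1, 2, 3, 1), (3, 2, 4, 1)]
  | .B20 => [(1, 1, 2, 1), (2, 1, 3, 1), (1, 2, 4, 1), (3, 1, 4, 1)]
  | .B21 => [(1, 1, 2, 1), (2, 1, 3, 1), (3, 1, 4, 1)]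
  | .B22 => [(1, 1, 2, 1), (1, 2, 3, 1), (1, 3, 4, 1), (2, 1, 4, 1)]
  | .B23 => [(1, 1, 2, 1), (1, 2, 3, 1), (1, 3, 4, 1), (2, 1, 3, 1), (2, 1, 4, 1),
      (2, 2, 4, 1), (3, 1, 4, 1)]
  | .B24 α => [(1, 1, 2, 1), (1, 2, 3, 1), (1, 3, 4, 1), (2, 1, 3, α),
      (2, 2, 4, α), (3, 1, 4, α)]

/-- The algebra with a given label. -/
abbrev TableA.Alg (T : TableA) : Type := T.mulTable.Alg

end Bicomm

/-!
The lower central series `C₀ = B`, `C_{k+1} = C_k B + B C_k` of a nilpotent algebra is strictly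
decreasing until it vanishes, and purity says `C₂ ≠ 0`; hence `C₁ = B²` has dimension two or three.
Bicommutativity enters through the fact that `C₁ C_k` and `C_k C₁` lie in `C_{k+2}`, because
`(xy)z = (xz)y` and `z(xy) = x(zy)`, and through the relations it imposes on the graded pieces.

If `dim B² = 3`, one element `a` generates `B`. Either `C₃ = 0` and `a`, `aa`, `(aa)a`, `a(aa)` is a
basis, or `C₂/C₃` and `C₃` are lines; then `(a(aa))a = (aa)(aa) = a((aa)a)` determines all products
up to one or two parameters (`IsBicommutative.inFamily_of_finrank_three`).

If `dim B² = 2`, then `C₂` is a line and `C₃ = 0`. The products of two generators modulo `C₂` are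
given by a bilinear form on `B/B²`, and the left and right actions of `B/B²` on `B²/C₂` by two
linear forms, not both zero. Bicommutativity makes the bilinear form a product `F ⊗ G` and the
linear forms multiples of `F` and `G` (`exists_eq_mul_of_comm`). According to whether `F` and `G`
are proportional or independent one obtains the families `symModel` and `asymModel`
(`IsBicommutative.inFamily_of_finrank_two`).

Within each family, explicit changes of basis (`HasModel.symModel_change`,
`HasModel.asymModel_change`, `HasModel.leftModel_change`, `HasModel.rightModel_change`) bring the
parameters to the normal forms of the list. Conversely, all algebras of the list belong to these
families (`inFamily_of_hasModel`), whose members are bicommutative and pure by computation and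
nilpotent because their structure constants are strictly triangular
(`InFamily.isNilpotentPureBicommutative`).
-/

namespace Bicomm

open Matrix Submodule

/-! ### Models of an algebra on `ℂ⁴` -/

/-- The algebra `B` is isomorphic to `ℂ⁴` with the product `m`. Bilinearity of `m` is not part of
the definition: it is inherited from the product of `B`. -/
def HasModel (B : Type*) [NonUnitalNonAssocRing B] [Module ℂ B]
    (m : (Fin 4 → ℂ) → (Fin 4 → ℂ) → (Fin 4 → ℂ)) : Prop :=
  ∃ e : (Fin 4 → ℂ) ≃ₗ[ℂ] B, ∀ x y, e x * e y = e (m x y)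

section Model

variable {B : Type*} [NonUnitalNonAssocRing B] [Module ℂ B]
  {m m' : (Fin 4 → ℂ) → (Fin 4 → ℂ) → (Fin 4 → ℂ)}

/-- Change of basis: the columns of `M` are the coordinates of the new basis in the old one. -/
theorem HasModel.changeBasis (h : HasModel B m) (M : Matrix (Fin 4) (Fin 4) ℂ) (hM : M.det ≠ 0)
    (hm : ∀ x y, m (M *ᵥ x) (M *ᵥ y) = M *ᵥ m' x y) : HasModel B m' := by
  obtain ⟨e, he⟩ := h
  refine ⟨(M.toLin'.equivOfDetNeZero ?_).trans e, fun x y => ?_⟩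
  · rwa [LinearMap.det_toLin']
  · have key : ∀ z, ((M.toLin'.equivOfDetNeZero (by rwa [LinearMap.det_toLin'])).trans e) z
        = e (M *ᵥ z) := fun z => by simp [LinearMap.equivOfDetNeZero]
    rw [key, key, key, he, hm]

theorem algIsomorphic_iff_hasModel (t : MulTable) (ht : ∀ x y : t.Alg, x * y = m x y) :
    AlgIsomorphic B t.Alg ↔ HasModel B m := by
  constructor
  · rintro ⟨f, hf⟩
    let g : B ≃ₗ[ℂ] (Fin 4 → ℂ) := LinearEquiv.ofBijective (f : B →ₗ[ℂ] t.Alg) hf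
    refine ⟨g.symm, fun x y => g.injective ?_⟩
    have hx : f (g.symm x) = (x : t.Alg) := g.apply_symm_apply x
    have hy : f (g.symm y) = (y : t.Alg) := g.apply_symm_apply y
    have hxy : f (g.symm x * g.symm y) = m x y := by
      rw [map_mul, hx, hy]
      exact ht x y
    exact hxy.trans (g.apply_symm_apply (m x y)).symm
  · rintro ⟨e, he⟩
    refine ⟨{ toFun := fun b => (e.symm b : Fin 4 → ℂ)
              map_smul' := fun a b => map_smul e.symm a b
              map_zero' := map_zero e.symm
              map_add' := fun a b => map_add e.symm a b
              map_mul' := fun a b => ?_ }, e.symm.bijective⟩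
    refine Eq.trans ?_ (ht (e.symm a) (e.symm b)).symm
    have hab : e.symm (a * b) = m (e.symm a) (e.symm b) := by
      rw [LinearEquiv.symm_apply_eq, ← he]
      simp
    exact hab

theorem HasModel.finrank_eq (h : HasModel B m) : Module.finrank ℂ B = 4 := by
  obtain ⟨e, -⟩ := h
  rw [← e.finrank_eq]
  simp

theorem HasModel.isBicommutative (h : HasModel B m)
    (h₁ : ∀ x y z, m (m x y) z = m (m x z) y) (h₂ : ∀ x y z, m x (m y z) = m y (m x z)) :
    IsBicommutative B := by
  obtain ⟨e, he⟩ := h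
  constructor <;> intro x y z <;>
    rw [← e.apply_symm_apply x, ← e.apply_symm_apply y, ← e.apply_symm_apply z] <;> simp only [he]
  · rw [h₁]
  · rw [h₂]

theorem HasModel.isPure (h : HasModel B m)
    (h' : ¬ ∀ x y z, m (m x y) z = 0 ∧ m x (m y z) = 0) : IsPure B := by
  obtain ⟨e, he⟩ := h
  intro hB
  refine h' fun x y z => ?_
  simpa [he] using hB (e x) (e y) (e z)

/-- An algebra is nilpotent if its structure constants in some basis are strictly triangular.
Indeed a product with a factor in `⟨e_{k+1}, …, e₄⟩` then lies in `⟨e_{k+2}, …, e₄⟩`, and one of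
the two outermost factors of a product of `2 ^ (k + 1)` elements is a product of at least `2 ^ k`
elements. -/
theorem HasModel.isNilpotentAlgebra (h : HasModel B m)
    (h' : ∀ (x y : Fin 4 → ℂ) (i : Fin 4),
      (∀ p q : Fin 4, p < i → q < i → x p * y q = 0) → m x y i = 0) : IsNilpotentAlgebra B := by
  obtain ⟨e, he⟩ := h
  have key : ∀ (n : ℕ) (b : B), IsProductOf n b →
      ∀ k : ℕ, 2 ^ k ≤ n → ∀ i : Fin 4, (i : ℕ) < k → e.symm b i = 0 := by
    intro n b hb
    induction hb with
    | single b =>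
      intro k hk i hi
      have : 2 ^ 1 ≤ 2 ^ k := Nat.pow_le_pow_right (by norm_num) (by omega)
      omega
    | @mul p q x y hx hy ihx ihy =>
      rintro (_ | k) hk i hi
      · omega
      have hxy : e.symm (x * y) = m (e.symm x) (e.symm y) := by
        rw [LinearEquiv.symm_apply_eq, ← he]
        simp
      rw [hxy]
      refine h' _ _ i fun a b ha hb => ?_
      rcases le_total p q with hpq | hpq
      · rw [ihy k (by rw [pow_succ] at hk; omega) b (by omega), mul_zero]
      · rw [ihx k (by rw [pow_succ] at hk; omega) a (by omega), zero_mul]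
  refine ⟨2 ^ 4, by norm_num, fun b hb => ?_⟩
  have : e.symm b = 0 := funext fun i => key _ b hb 4 le_rfl i i.2
  simpa using this

end Model

/-! ### The families of products -/

/-- Two generators `e₁, e₃`, and the form `B/B² × B/B² → B²/C₂` is the square of a functional:
`e₁e₁ = e₂`, `e₁e₂ = l e₄`, `e₂e₁ = r e₄`, `e₁e₃ = p e₄`, `e₃e₁ = q e₄`, `e₃e₃ = s e₄`. -/
def symModel (l r p q s : ℂ) (x y : Fin 4 → ℂ) : Fin 4 → ℂ :=
  ![0, x 0 * y 0, 0,
    l * (x 0 * y 1) + r * (x 1 * y 0) + p * (x 0 * y 2) + q * (x 2 * y 0) + s * (x 2 * y 2)]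

/-- Two generators `e₁, e₂`, and the form `B/B² × B/B² → B²/C₂` is the product of two independent
functionals:
`e₁e₂ = e₃`, `e₁e₃ = l e₄`, `e₃e₂ = r e₄`, `e₁e₁ = p e₄`, `e₂e₁ = q e₄`, `e₂e₂ = s e₄`. -/
def asymModel (l r p q s : ℂ) (x y : Fin 4 → ℂ) : Fin 4 → ℂ :=
  ![0, 0, x 0 * y 1,
    l * (x 0 * y 2) + r * (x 2 * y 1) + p * (x 0 * y 0) + q * (x 1 * y 0) + s * (x 1 * y 1)]

/-- One generator `a = e₁`, and the basis `a`, `aa`, `a(aa)`, `a(a(aa))`; the parameters are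
those of `(aa)a = α e₃ + β e₄`. -/
def leftModel (α β : ℂ) (x y : Fin 4 → ℂ) : Fin 4 → ℂ :=
  ![0, x 0 * y 0, x 0 * y 1 + α * (x 1 * y 0),
    β * (x 1 * y 0) + x 0 * y 2 + α * (x 2 * y 0) + α * (x 1 * y 1)]

/-- One generator `a = e₁`, and the basis `a`, `aa`, `(aa)a`, `((aa)a)a`; the parameter is that
of `a(aa) = ε e₄`. -/
def rightModel (ε : ℂ) (x y : Fin 4 → ℂ) : Fin 4 → ℂ :=
  ![0, x 0 * y 0, x 1 * y 0, ε * (x 0 * y 1) + x 2 * y 0]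

/-- One generator `a = e₁`, and the basis `a`, `aa`, `(aa)a`, `a(aa)`. -/
def freeModel (x y : Fin 4 → ℂ) : Fin 4 → ℂ :=
  ![0, x 0 * y 0, x 1 * y 0, x 0 * y 1]

/-- The algebra `B` belongs to one of the families of nilpotent pure bicommutative algebras. -/
def InFamily (B : Type*) [NonUnitalNonAssocRing B] [Module ℂ B] : Prop :=
  (∃ l r p q s : ℂ, (l ≠ 0 ∨ r ≠ 0) ∧ HasModel B (symModel l r p q s)) ∨
  (∃ l r p q s : ℂ, (l ≠ 0 ∨ r ≠ 0) ∧ HasModel B (asymModel l r p q s)) ∨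
  (∃ α β : ℂ, HasModel B (leftModel α β)) ∨
  (∃ ε : ℂ, HasModel B (rightModel ε)) ∨
  HasModel B freeModel

section Family

variable {B : Type*} [NonUnitalNonAssocRing B] [Module ℂ B]

/-- The algebras of the families are nilpotent pure bicommutative of dimension four. -/
theorem InFamily.isNilpotentPureBicommutative (h : InFamily B) :
    Module.finrank ℂ B = 4 ∧ IsBicommutative B ∧ IsNilpotentAlgebra B ∧ IsPure B := by
  rcases h with ⟨l, r, p, q, s, hlr, h⟩ | ⟨l, r, p, q, s, hlr, h⟩ | ⟨α, β, h⟩ | ⟨ε, h⟩ | h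
  · refine ⟨h.finrank_eq, h.isBicommutative ?_ ?_, h.isNilpotentAlgebra ?_, h.isPure ?_⟩
    · intro x y z; ext i; fin_cases i <;>
        simp [symModel, -mul_eq_mul_left_iff, -mul_eq_mul_right_iff]
      ring
    · intro x y z; ext i; fin_cases i <;>
        simp [symModel, -mul_eq_mul_left_iff, -mul_eq_mul_right_iff]
      ring
    · intro x y i h; fin_cases i <;> simp [symModel, -mul_eq_zero, h]
    · intro H
      have := H ![1, 0, 0, 0] ![1, 0, 0, 0] ![1, 0, 0, 0]
      simp [symModel] at this
      tauto
  · refine ⟨h.finrank_eq, h.isBicommutative ?_ ?_, h.isNilpotentAlgebra ?_, h.isPure ?_⟩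
    · intro x y z; ext i; fin_cases i <;>
        simp [asymModel, -mul_eq_mul_left_iff, -mul_eq_mul_right_iff]
      ring
    · intro x y z; ext i; fin_cases i <;>
        simp [asymModel, -mul_eq_mul_left_iff, -mul_eq_mul_right_iff]
      ring
    · intro x y i h; fin_cases i <;> simp [asymModel, -mul_eq_zero, h]
    · intro H
      have h₁ := H ![1, 0, 0, 0] ![1, 0, 0, 0] ![0, 1, 0, 0]
      have h₂ := H ![1, 0, 0, 0] ![0, 1, 0, 0] ![0, 1, 0, 0]
      simp [asymModel] at h₁ h₂
      tauto
  · refine ⟨h.finrank_eq, h.isBicommutative ?_ ?_, h.isNilpotentAlgebra ?_, h.isPure ?_⟩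
    · intro x y z; ext i; fin_cases i <;>
        simp [leftModel, -mul_eq_mul_left_iff, -mul_eq_mul_right_iff] <;> ring
    · intro x y z; ext i; fin_cases i <;>
        simp [leftModel, -mul_eq_mul_left_iff, -mul_eq_mul_right_iff] <;> ring
    · intro x y i h; fin_cases i <;> simp [leftModel, -mul_eq_zero, h]
    · intro H
      have := H ![1, 0, 0, 0] ![1, 0, 0, 0] ![1, 0, 0, 0]
      simp [leftModel] at this
  · refine ⟨h.finrank_eq, h.isBicommutative ?_ ?_, h.isNilpotentAlgebra ?_, h.isPure ?_⟩
    · intro x y z; ext i; fin_cases i <;>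
        simp [rightModel, -mul_eq_mul_left_iff, -mul_eq_mul_right_iff] <;> ring
    · intro x y z; ext i; fin_cases i <;>
        simp [rightModel, -mul_eq_mul_left_iff, -mul_eq_mul_right_iff]
      ring
    · intro x y i h; fin_cases i <;> simp [rightModel, -mul_eq_zero, h]
    · intro H
      have := H ![1, 0, 0, 0] ![1, 0, 0, 0] ![1, 0, 0, 0]
      simp [rightModel] at this
  · refine ⟨h.finrank_eq, h.isBicommutative ?_ ?_, h.isNilpotentAlgebra ?_, h.isPure ?_⟩
    · intro x y z; ext i; fin_cases i <;>
        simp [freeModel, -mul_eq_mul_left_iff, -mul_eq_mul_right_iff]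
      ring
    · intro x y z; ext i; fin_cases i <;>
        simp [freeModel, -mul_eq_mul_left_iff, -mul_eq_mul_right_iff]
      ring
    · intro x y i h; fin_cases i <;> simp [freeModel, -mul_eq_zero, h]
    · intro H
      have := H ![1, 0, 0, 0] ![1, 0, 0, 0] ![1, 0, 0, 0]
      simp [freeModel] at this

end Family

/-! ### The algebras of the list belong to the families -/

section Table

variable {B : Type*} [NonUnitalNonAssocRing B] [Module ℂ B]

/-- The product of `ℂ⁴` which describes the algebra with a given label. In `B⁴₀₁` and `B⁴₀₂(α)`
the roles of `e₃` and `e₄` are exchanged with respect to `symModel`. -/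
def TableA.model : TableA → (Fin 4 → ℂ) → (Fin 4 → ℂ) → (Fin 4 → ℂ)
  | .B01 => fun x y => ![0, x 0 * y 0, x 1 * y 0, 0]
  | .B02 α => fun x y => ![0, x 0 * y 0, x 0 * y 1 + α * (x 1 * y 0), 0]
  | .B03 => freeModel
  | .B04 α => symModel 1 α 0 0 1
  | .B05 => symModel 1 1 1 0 1
  | .B06 α _ => symModel 1 α 1 0 0
  | .B07 => symModel 0 1 0 0 1
  | .B08 => symModel 0 1 1 0 0
  | .B09 => symModel 1 0 0 1 0
  | .B10 => asymModel 1 1 0 1 0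
  | .B11 => asymModel 1 1 0 0 0
  | .B12 => asymModel 0 1 1 1 0
  | .B13 => asymModel 0 1 0 1 0
  | .B14 => asymModel 1 0 0 1 1
  | .B15 => asymModel 1 0 0 1 0
  | .B16 => asymModel 1 0 0 0 1
  | .B17 => asymModel 1 0 0 0 0
  | .B18 => asymModel 0 1 1 0 0
  | .B19 => asymModel 0 1 0 0 0
  | .B20 => rightModel 1
  | .B21 => rightModel 0
  | .B22 => leftModel 0 1
  | .B23 => leftModel 1 1
  | .B24 α => leftModel α 0

theorem TableA.mul_eq_model (T : TableA) (x y : T.Alg) : x * y = T.model x y := by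
  funext k
  rw [MulTable.mul_apply]
  cases T <;> fin_cases k <;>
    simp [Fin.sum_univ_four, MulTable.coeff, TableA.mulTable, TableA.model, symModel, asymModel,
      leftModel, rightModel, freeModel] <;> ring

theorem TableA.algIsomorphic_iff (T : TableA) : AlgIsomorphic B T.Alg ↔ HasModel B T.model :=
  algIsomorphic_iff_hasModel _ T.mul_eq_model

/-- The matrix exchanging the last two basis vectors. -/
def swapMatrix : Matrix (Fin 4) (Fin 4) ℂ := !![1, 0, 0, 0; 0, 1, 0, 0; 0, 0, 0, 1; 0, 0, 1, 0]

theorem hasModel_B01_iff : HasModel B TableA.B01.model ↔ HasModel B (symModel 0 1 0 0 0) := by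
  constructor <;> intro h <;> refine h.changeBasis swapMatrix ?_ fun x y => ?_
  · simp [swapMatrix, det_succ_row_zero, Fin.sum_univ_succ, Fin.succAbove]
  · ext i; fin_cases i <;>
      simp [swapMatrix, mulVec, dotProduct, Fin.sum_univ_four, symModel, TableA.model]
  · simp [swapMatrix, det_succ_row_zero, Fin.sum_univ_succ, Fin.succAbove]
  · ext i; fin_cases i <;>
      simp [swapMatrix, mulVec, dotProduct, Fin.sum_univ_four, symModel, TableA.model]

theorem hasModel_B02_iff (α : ℂ) :
    HasModel B (TableA.B02 α).model ↔ HasModel B (symModel 1 α 0 0 0) := by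
  constructor <;> intro h <;> refine h.changeBasis swapMatrix ?_ fun x y => ?_
  · simp [swapMatrix, det_succ_row_zero, Fin.sum_univ_succ, Fin.succAbove]
  · ext i; fin_cases i <;>
      simp [swapMatrix, mulVec, dotProduct, Fin.sum_univ_four, symModel, TableA.model]
  · simp [swapMatrix, det_succ_row_zero, Fin.sum_univ_succ, Fin.succAbove]
  · ext i; fin_cases i <;>
      simp [swapMatrix, mulVec, dotProduct, Fin.sum_univ_four, symModel, TableA.model]

theorem inFamily_of_hasModel {T : TableA} (h : HasModel B T.model) : InFamily B := by
  cases T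
  case B01 => exact Or.inl ⟨_, _, _, _, _, by simp, hasModel_B01_iff.1 h⟩
  case B02 α => exact Or.inl ⟨_, _, _, _, _, by simp, (hasModel_B02_iff α).1 h⟩
  case B03 => exact Or.inr (Or.inr (Or.inr (Or.inr h)))
  case B20 | B21 => exact Or.inr (Or.inr (Or.inr (Or.inl ⟨_, h⟩)))
  case B22 | B23 | B24 => exact Or.inr (Or.inr (Or.inl ⟨_, _, h⟩))
  case B04 | B05 | B06 | B07 | B08 | B09 => exact Or.inl ⟨_, _, _, _, _, by simp, h⟩
  all_goals exact Or.inr (Or.inl ⟨_, _, _, _, _, by simp, h⟩)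

/-! ### Normal forms within the families -/

/-- The change of basis `a' = c (a + t b)`, `b' = d (b + z u)`, `u' = a' a'`, with the last basis
vector divided by `w`. -/
theorem HasModel.symModel_change {l r p q s : ℂ} (h : HasModel B (symModel l r p q s))
    {c d w : ℂ} (t z : ℂ) (hc : c ≠ 0) (hd : d ≠ 0) (hw : w ≠ 0) {l' r' p' q' s' : ℂ}
    (hl : w * l' = c ^ 3 * l) (hr : w * r' = c ^ 3 * r)
    (hp : w * p' = c * d * (p + l * z + t * s)) (hq : w * q' = c * d * (q + r * z + t * s))
    (hs : w * s' = d ^ 2 * s) : HasModel B (symModel l' r' p' q' s') := by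
  refine h.changeBasis !![c, 0, 0, 0; 0, c ^ 2, d * z, 0; c * t, 0, d, 0;
    0, c ^ 2 * (t * (p + q) + t ^ 2 * s), 0, w] ?_ fun x y => ?_
  · simp [det_succ_row_zero, Fin.sum_univ_succ, Fin.succAbove, hc, hd, hw]
  · ext i; fin_cases i <;> simp [mulVec, dotProduct, Fin.sum_univ_four, symModel]
    · ring
    · linear_combination (-(x 0 * y 1)) * hl - x 1 * y 0 * hr - x 0 * y 2 * hp
        - x 2 * y 0 * hq - x 2 * y 2 * hs

/-- The change of basis `e₁' = c (e₁ + t e₃)`, `e₂' = d (e₂ + z e₃)`, `e₃' = e₁' e₂'`, with the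
last basis vector divided by `w`. -/
theorem HasModel.asymModel_change {l r p q s : ℂ} (h : HasModel B (asymModel l r p q s))
    {c d w : ℂ} (t z : ℂ) (hc : c ≠ 0) (hd : d ≠ 0) (hw : w ≠ 0) {l' r' p' q' s' : ℂ}
    (hl : w * l' = c ^ 2 * d * l) (hr : w * r' = c * d ^ 2 * r)
    (hp : w * p' = c ^ 2 * (p + l * t)) (hq : w * q' = c * d * q)
    (hs : w * s' = d ^ 2 * (s + r * z)) : HasModel B (asymModel l' r' p' q' s') := by
  refine h.changeBasis !![c, 0, 0, 0; 0, d, 0, 0; c * t, d * z, c * d, 0;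
    0, 0, c * d * (l * z + r * t), w] ?_ fun x y => ?_
  · simp [det_succ_row_zero, Fin.sum_univ_succ, Fin.succAbove, hc, hd, hw]
  · ext i; fin_cases i <;> simp [mulVec, dotProduct, Fin.sum_univ_four, asymModel]
    · ring
    · linear_combination (-(x 0 * y 2)) * hl - x 2 * y 1 * hr - x 0 * y 0 * hp
        - x 1 * y 0 * hq - x 1 * y 1 * hs

/-- The change of generator `a' = c (a + t aa)`. It shows that `β` matters only for
`α = 0` and `α = 1`. -/
theorem HasModel.leftModel_change {α β : ℂ} (h : HasModel B (leftModel α β))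
    {c : ℂ} (t : ℂ) (hc : c ≠ 0) {β' : ℂ} (hβ : c * β' = β + t * α * (1 - α)) :
    HasModel B (leftModel α β') := by
  refine h.changeBasis !![c, 0, 0, 0; c * t, c ^ 2, 0, 0; 0, c ^ 2 * (t * (1 + α)), c ^ 3, 0;
    0, c ^ 2 * (t * β + t ^ 2 * α), c ^ 3 * (t * (1 + 2 * α)), c ^ 4] ?_ fun x y => ?_
  · simp [det_succ_row_zero, Fin.sum_univ_succ, Fin.succAbove, hc]
  · ext i; fin_cases i <;> simp [mulVec, dotProduct, Fin.sum_univ_four, leftModel]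
    · ring
    · ring
    · linear_combination (-(c ^ 3 * x 1 * y 0)) * hβ

/-- The change of generator `a' = ε a`. -/
theorem HasModel.rightModel_change {ε : ℂ} (h : HasModel B (rightModel ε)) (hε : ε ≠ 0) :
    HasModel B (rightModel 1) := by
  refine h.changeBasis !![ε, 0, 0, 0; 0, ε ^ 2, 0, 0; 0, 0, ε ^ 3, 0; 0, 0, 0, ε ^ 4]
    ?_ fun x y => ?_
  · simp [det_succ_row_zero, Fin.sum_univ_succ, Fin.succAbove, hε]
  · ext i; fin_cases i <;> simp [mulVec, dotProduct, Fin.sum_univ_four, rightModel] <;> ring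

/-- For `s ≠ 0` the parameters `p` and `q` can both be removed if `l ≠ r`, and one of them if
`l = r`; for `s = 0` the pair `(p, q)` matters only modulo `(l, r)`. -/
theorem HasModel.exists_label_of_symModel {l r p q s : ℂ} (hlr : l ≠ 0 ∨ r ≠ 0)
    (h : HasModel B (symModel l r p q s)) : ∃ T : TableA, HasModel B T.model := by
  by_cases hs : s = 0
  · subst hs
    by_cases hl : l = 0
    · subst hl
      have hr : r ≠ 0 := by tauto
      by_cases hp : p = 0
      · subst hp
        refine ⟨.B01, hasModel_B01_iff.2 ?_⟩
        refine h.symModel_change (c := 1) (d := 1) (w := r) 0 (-q / r) one_ne_zero one_ne_zero hr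
          ?_ ?_ ?_ ?_ ?_ <;> field_simp <;> ring
      · refine ⟨.B08, ?_⟩
        refine h.symModel_change (c := 1) (d := r / p) (w := r) 0 (-q / r) one_ne_zero
          (div_ne_zero hr hp) hr ?_ ?_ ?_ ?_ ?_ <;> field_simp <;> ring
    · by_cases hr : r = 0
      · subst hr
        by_cases hq : q = 0
        · subst hq
          refine ⟨.B02 0, (hasModel_B02_iff 0).2 ?_⟩
          refine h.symModel_change (c := 1) (d := 1) (w := l) 0 (-p / l) one_ne_zero one_ne_zero hl
            ?_ ?_ ?_ ?_ ?_ <;> field_simp <;> ring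
        · refine ⟨.B09, ?_⟩
          refine h.symModel_change (c := 1) (d := l / q) (w := l) 0 (-p / l) one_ne_zero
            (div_ne_zero hl hq) hl ?_ ?_ ?_ ?_ ?_ <;> field_simp <;> ring
      · by_cases hp : p * r = l * q
        · refine ⟨.B02 (r / l), (hasModel_B02_iff _).2 ?_⟩
          refine h.symModel_change (c := 1) (d := 1) (w := l) 0 (-q / r) one_ne_zero one_ne_zero hl
            ?_ ?_ ?_ ?_ ?_ <;> field_simp <;> first | ring1 | linear_combination -hp
        · -- `k` is the determinant of `(p, q)` and `(l, r)`.
          obtain ⟨k, rfl⟩ : ∃ k, p = (l * q + k) / r := ⟨p * r - l * q, by field_simp; ring⟩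
          have hk : k ≠ 0 := by
            rintro rfl
            exact hp (by field_simp; ring)
          refine ⟨.B06 (r / l) (div_ne_zero hr hl), ?_⟩
          refine h.symModel_change (c := 1) (d := l * r / k) (w := l) 0 (-q / r)
            one_ne_zero (by positivity) hl ?_ ?_ ?_ ?_ ?_ <;> field_simp <;> ring
  · by_cases hl : l = 0
    · subst hl
      have hr : r ≠ 0 := by tauto
      -- With `d² = r / s` the products `u' a'` and `b' b'` become equal.
      obtain ⟨d, hd⟩ := IsAlgClosed.exists_pow_nat_eq (r / s) two_pos
      have hd0 : d ≠ 0 := by rintro rfl; simp [hr, hs, eq_comm] at hd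
      refine ⟨.B07, ?_⟩
      refine h.symModel_change (c := 1) (d := d) (w := r) (-p / s) ((p - q) / r) one_ne_zero hd0 hr
        ?_ ?_ ?_ ?_ ?_ <;> (try rw [hd]) <;> field_simp <;> ring
    · -- With `d² = l / s` the products `a' u'` and `b' b'` become equal.
      obtain ⟨d, hd⟩ := IsAlgClosed.exists_pow_nat_eq (l / s) two_pos
      have hd0 : d ≠ 0 := by rintro rfl; simp [hl, hs, eq_comm] at hd
      by_cases hr : r = l
      · subst hr
        by_cases hp : p = q
        · subst hp
          refine ⟨.B04 1, ?_⟩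
          refine h.symModel_change (c := 1) (d := d) (w := r) (-p / s) 0 one_ne_zero hd0 hl
            ?_ ?_ ?_ ?_ ?_ <;> (try rw [hd]) <;> field_simp <;> ring
        · obtain ⟨k, rfl⟩ : ∃ k, p = q + k := ⟨p - q, by ring⟩
          have hk : k ≠ 0 := by rintro rfl; simp at hp
          refine ⟨.B05, ?_⟩
          refine h.symModel_change (c := k ^ 2 / (s * r)) (d := k ^ 3 / (s ^ 2 * r))
            (w := k ^ 6 / (s ^ 3 * r ^ 2)) (-q / s) 0 (by positivity) (by positivity)
            (by positivity) ?_ ?_ ?_ ?_ ?_ <;> field_simp <;> ring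
      · have hlr' : l - r ≠ 0 := sub_ne_zero.2 (Ne.symm hr)
        refine ⟨.B04 (r / l), ?_⟩
        refine h.symModel_change (c := 1) (d := d) (w := l) (-(l * q - p * r) / (s * (l - r)))
          ((q - p) / (l - r)) one_ne_zero hd0 hl
          ?_ ?_ ?_ ?_ ?_ <;> (try rw [hd]) <;> field_simp <;> ring

/-- The parameter `p` can be removed if `l ≠ 0`, and `s` if `r ≠ 0`; the nonzero parameters that
remain can be scaled to `1`. -/
theorem HasModel.exists_label_of_asymModel {l r p q s : ℂ} (hlr : l ≠ 0 ∨ r ≠ 0)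
    (h : HasModel B (asymModel l r p q s)) : ∃ T : TableA, HasModel B T.model := by
  by_cases hl : l = 0
  · subst hl
    have hr : r ≠ 0 := by tauto
    by_cases hp : p = 0
    · subst hp
      by_cases hq : q = 0
      · subst hq
        refine ⟨.B19, ?_⟩
        refine h.asymModel_change (c := 1) (d := 1) (w := r) 0 (-s / r) one_ne_zero one_ne_zero hr
          ?_ ?_ ?_ ?_ ?_ <;> field_simp <;> ring
      · refine ⟨.B13, ?_⟩
        refine h.asymModel_change (c := 1) (d := q / r) (w := q ^ 2 / r) 0 (-s / r) one_ne_zero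
          (by positivity) (by positivity) ?_ ?_ ?_ ?_ ?_ <;> field_simp <;> ring
    · by_cases hq : q = 0
      · subst hq
        refine ⟨.B18, ?_⟩
        refine h.asymModel_change (c := r / p) (d := 1) (w := r ^ 2 / p) 0 (-s / r) (by positivity)
          one_ne_zero (by positivity) ?_ ?_ ?_ ?_ ?_ <;> field_simp <;> ring
      · refine ⟨.B12, ?_⟩
        refine h.asymModel_change (c := q ^ 2 / (r * p)) (d := q / r) (w := q ^ 4 / (r ^ 2 * p))
          0 (-s / r) (by positivity) (by positivity) (by positivity) ?_ ?_ ?_ ?_ ?_ <;>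
          field_simp <;> ring
  · by_cases hr : r = 0
    · subst hr
      by_cases hs : s = 0
      · subst hs
        by_cases hq : q = 0
        · subst hq
          refine ⟨.B17, ?_⟩
          refine h.asymModel_change (c := 1) (d := 1) (w := l) (-p / l) 0 one_ne_zero one_ne_zero
            hl ?_ ?_ ?_ ?_ ?_ <;> field_simp <;> ring
        · refine ⟨.B15, ?_⟩
          refine h.asymModel_change (c := q / l) (d := 1) (w := q ^ 2 / l) (-p / l) 0
            (by positivity) one_ne_zero (by positivity) ?_ ?_ ?_ ?_ ?_ <;> field_simp <;> ring
      · by_cases hq : q = 0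
        · subst hq
          refine ⟨.B16, ?_⟩
          refine h.asymModel_change (c := 1) (d := l / s) (w := l ^ 2 / s) (-p / l) 0
            one_ne_zero (by positivity) (by positivity) ?_ ?_ ?_ ?_ ?_ <;> field_simp <;> ring
        · refine ⟨.B14, ?_⟩
          refine h.asymModel_change (c := q / l) (d := q ^ 2 / (l * s)) (w := q ^ 4 / (l ^ 2 * s))
            (-p / l) 0 (by positivity) (by positivity) (by positivity) ?_ ?_ ?_ ?_ ?_ <;>
            field_simp <;> ring
    · by_cases hq : q = 0
      · subst hq
        refine ⟨.B11, ?_⟩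
        refine h.asymModel_change (c := r) (d := l) (w := l ^ 2 * r ^ 2) (-p / l) (-s / r)
          hr hl (by positivity) ?_ ?_ ?_ ?_ ?_ <;> field_simp <;> ring
      · refine ⟨.B10, ?_⟩
        refine h.asymModel_change (c := q / l) (d := q / r) (w := q ^ 3 / (l * r)) (-p / l) (-s / r)
          (by positivity) (by positivity) (by positivity) ?_ ?_ ?_ ?_ ?_ <;> field_simp <;> ring

theorem HasModel.exists_label_of_leftModel {α β : ℂ}
    (h : HasModel B (leftModel α β)) : ∃ T : TableA, HasModel B T.model := by
  by_cases hβ : β = 0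
  · exact ⟨.B24 α, by rwa [hβ] at h⟩
  by_cases h0 : α = 0
  · subst h0
    exact ⟨.B22, h.leftModel_change 0 hβ (by ring)⟩
  by_cases h1 : α = 1
  · subst h1
    exact ⟨.B23, h.leftModel_change 0 hβ (by ring)⟩
  have h1' : 1 - α ≠ 0 := sub_ne_zero.2 (Ne.symm h1)
  refine ⟨.B24 α, h.leftModel_change (c := 1) (-β / (α * (1 - α))) one_ne_zero ?_⟩
  field_simp
  ring

theorem InFamily.exists_label (h : InFamily B) : ∃ T : TableA, HasModel B T.model := by
  rcases h with ⟨l, r, p, q, s, hlr, h⟩ | ⟨l, r, p, q, s, hlr, h⟩ | ⟨α, β, h⟩ | ⟨ε, h⟩ | h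
  · exact h.exists_label_of_symModel hlr
  · exact h.exists_label_of_asymModel hlr
  · exact h.exists_label_of_leftModel
  · by_cases hε : ε = 0
    · exact ⟨.B21, by rwa [hε] at h⟩
    · exact ⟨.B20, h.rightModel_change hε⟩
  · exact ⟨.B03, h⟩

end Table

/-! ### The lower central series -/

section LowerSeries

variable (B : Type*) [NonUnitalNonAssocRing B] [Module ℂ B]

/-- The lower central series `C₀ = B`, `C_{k+1} = C_k B + B C_k`. -/
def lowerSeries : ℕ → Submodule ℂ B
  | 0 => ⊤
  | k + 1 => span ℂ {z | ∃ x ∈ lowerSeries k, ∃ y, z = x * y ∨ z = y * x}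

variable {B}

theorem mul_mem_lowerSeries {k : ℕ} {x : B} (hx : x ∈ lowerSeries B k) (y : B) :
    x * y ∈ lowerSeries B (k + 1) :=
  subset_span ⟨x, hx, y, Or.inl rfl⟩

theorem mul_mem_lowerSeries' {k : ℕ} {x : B} (hx : x ∈ lowerSeries B k) (y : B) :
    y * x ∈ lowerSeries B (k + 1) :=
  subset_span ⟨x, hx, y, Or.inr rfl⟩

theorem mul_mem_lowerSeries_one (x y : B) : x * y ∈ lowerSeries B 1 :=
  mul_mem_lowerSeries (k := 0) mem_top y

theorem lowerSeries_succ_le (k : ℕ) : lowerSeries B (k + 1) ≤ lowerSeries B k := by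
  induction k with
  | zero => exact le_top
  | succ k ih =>
    exact span_mono fun z ⟨x, hx, y, hz⟩ => ⟨x, ih hx, y, hz⟩

theorem IsPure.lowerSeries_two_ne_bot (hp : IsPure B) : lowerSeries B 2 ≠ ⊥ := by
  intro h2
  refine hp fun x y z => ⟨?_, ?_⟩ <;> rw [← mem_bot ℂ, ← h2]
  · exact mul_mem_lowerSeries (mul_mem_lowerSeries_one x y) z
  · exact mul_mem_lowerSeries' (mul_mem_lowerSeries_one y z) x

/-- If the series is stationary at one step, it is constant from there on. -/
theorem lowerSeries_succ_eq_of_eq {k : ℕ} (h : lowerSeries B (k + 1) = lowerSeries B k) (n : ℕ) :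
    lowerSeries B (k + n) = lowerSeries B k := by
  induction n with
  | zero => rfl
  | succ n ih =>
    rw [← add_assoc, lowerSeries, ih]
    exact h

/-- In a bicommutative algebra, multiplication by an element of `C₁` advances two steps in the
lower central series, because `(xy)z = (xz)y`. -/
theorem IsBicommutative.mul_mem_left [IsScalarTower ℂ B B] (h : IsBicommutative B) {k : ℕ}
    {x z : B} (hx : x ∈ lowerSeries B 1) (hz : z ∈ lowerSeries B k) :
    x * z ∈ lowerSeries B (k + 2) := by
  refine (span_le.2 ?_ : lowerSeries B 1 ≤ (lowerSeries B (k + 2)).comap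
    (LinearMap.mulRight ℂ z)) hx
  rintro w ⟨a, -, b, rfl | rfl⟩ <;> simp only [SetLike.mem_coe, mem_comap,
    LinearMap.mulRight_apply, h.1 _ _ z]
  all_goals exact mul_mem_lowerSeries (mul_mem_lowerSeries' hz _) _

theorem IsBicommutative.mul_mem_right [SMulCommClass ℂ B B] (h : IsBicommutative B) {k : ℕ}
    {x z : B} (hx : x ∈ lowerSeries B 1) (hz : z ∈ lowerSeries B k) :
    z * x ∈ lowerSeries B (k + 2) := by
  refine (span_le.2 ?_ : lowerSeries B 1 ≤ (lowerSeries B (k + 2)).comap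
    (LinearMap.mulLeft ℂ z)) hx
  rintro w ⟨a, -, b, rfl | rfl⟩ <;> simp only [SetLike.mem_coe, mem_comap,
    LinearMap.mulLeft_apply, h.2 z]
  all_goals exact mul_mem_lowerSeries' (mul_mem_lowerSeries hz _) _

variable [IsScalarTower ℂ B B] [SMulCommClass ℂ B B]

theorem lowerSeries_le_span (k : ℕ) : lowerSeries B k ≤ span ℂ {x | IsProductOf (k + 1) x} := by
  induction k with
  | zero => exact fun x _ => subset_span (IsProductOf.single x)
  | succ k ih =>
    refine span_le.2 ?_
    rintro z ⟨x, hx, y, hz⟩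
    have hx' := ih hx
    rcases hz with rfl | rfl
    · refine (span_le.2 ?_ : _ ≤ (span ℂ {x : B | IsProductOf (k + 1 + 1) x}).comap
        (LinearMap.mulRight ℂ y)) hx'
      exact fun w hw => subset_span (hw.mul (.single y))
    · refine (span_le.2 ?_ : _ ≤ (span ℂ {x : B | IsProductOf (k + 1 + 1) x}).comap
        (LinearMap.mulLeft ℂ y)) hx'
      intro w hw
      refine subset_span ?_
      have := (IsProductOf.single y).mul hw
      rwa [add_comm 1] at this

theorem IsNilpotentAlgebra.lowerSeries_lt (h : IsNilpotentAlgebra B) {k : ℕ}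
    (hk : lowerSeries B k ≠ ⊥) : lowerSeries B (k + 1) < lowerSeries B k := by
  refine (lowerSeries_succ_le k).lt_of_ne fun heq => hk ?_
  obtain ⟨n, hn, hB⟩ := h
  have hbot : lowerSeries B (k + (n - 1)) ≤ ⊥ := by
    have hle : lowerSeries B (k + (n - 1)) ≤ lowerSeries B (n - 1) := by
      have : Antitone (lowerSeries B) := antitone_nat_of_succ_le lowerSeries_succ_le
      exact this (by omega)
    refine (hle.trans (lowerSeries_le_span _)).trans (span_le.2 fun x hx => ?_)
    rw [Nat.sub_add_cancel hn] at hx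
    simpa using hB x hx
  rw [lowerSeries_succ_eq_of_eq heq] at hbot
  exact le_bot_iff.1 hbot

/-- If `B` is generated by `a`, and `u` spans `C_k` modulo `C_{k+1}`, then `au` and `ua` span
`C_{k+1}` modulo `C_{k+2}`. -/
theorem IsBicommutative.lowerSeries_succ_le_sup (h : IsBicommutative B) {a u : B} {k : ℕ}
    (ha : lowerSeries B 0 ≤ span ℂ {a} ⊔ lowerSeries B 1) (hu : u ∈ lowerSeries B k)
    (hk : lowerSeries B k ≤ span ℂ {u} ⊔ lowerSeries B (k + 1)) :
    lowerSeries B (k + 1) ≤ span ℂ {a * u, u * a} ⊔ lowerSeries B (k + 2) := by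
  refine span_le.2 ?_
  rintro z ⟨x, hx, y, hz⟩
  obtain ⟨x₁, hx₁, c, hc, rfl⟩ := mem_sup.1 (hk hx)
  obtain ⟨y₁, hy₁, d, hd, rfl⟩ := mem_sup.1 (ha (mem_top : y ∈ lowerSeries B 0))
  obtain ⟨s, rfl⟩ := mem_span_singleton.1 hx₁
  obtain ⟨t, rfl⟩ := mem_span_singleton.1 hy₁
  have hau : a * u ∈ span ℂ {a * u, u * a} := subset_span (by simp)
  have hua : u * a ∈ span ℂ {a * u, u * a} := subset_span (by simp)
  rcases hz with rfl | rfl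
  · have : (s • u + c) * (t • a + d) = (s * t) • (u * a) + (s • (u * d) + c * (t • a + d)) := by
      simp only [add_mul, mul_add, smul_mul_assoc, mul_smul_comm]
      module
    rw [this]
    exact add_mem_sup (smul_mem _ _ hua)
      (add_mem (smul_mem _ _ (h.mul_mem_right hd hu)) (mul_mem_lowerSeries hc _))
  · have : (t • a + d) * (s • u + c) = (s * t) • (a * u) + (s • (d * u) + (t • a + d) * c) := by
      simp only [add_mul, mul_add, smul_mul_assoc, mul_smul_comm]
      module
    rw [this]
    exact add_mem_sup (smul_mem _ _ hau)
      (add_mem (smul_mem _ _ (h.mul_mem_left hd hu)) (mul_mem_lowerSeries' hc _))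

end LowerSeries

/-! ### Adapted bases -/

section Basis

variable {B : Type*} [AddCommGroup B] [Module ℂ B]

theorem exists_equiv_of_span_eq_top (hB : Module.finrank ℂ B = 4) {a b c d : B}
    (h : ∀ x, x ∈ span ℂ {a, b, c, d}) :
    ∃ e : (Fin 4 → ℂ) ≃ₗ[ℂ] B, ∀ x, e x = x 0 • a + x 1 • b + x 2 • c + x 3 • d := by
  have hspan : ⊤ ≤ span ℂ (Set.range ![a, b, c, d]) := by
    intro x _
    have : Set.range ![a, b, c, d] = {a, b, c, d} := by
      ext y
      simp only [Set.mem_range, Fin.exists_fin_succ, Set.mem_insert_iff, Set.mem_singleton_iff]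
      simp [eq_comm (b := y)]
    rw [this]
    exact h x
  refine ⟨(basisOfTopLeSpanOfCardEqFinrank _ hspan (by simp [hB])).equivFun.symm, fun x => ?_⟩
  rw [Module.Basis.equivFun_symm_apply, Fin.sum_univ_four]
  simp

/-- A basis adapted to a filtration spans. -/
theorem mem_span_of_chain {a b c d : B} {S T U : Submodule ℂ B} (ha : ⊤ ≤ span ℂ {a} ⊔ S)
    (hb : S ≤ span ℂ {b} ⊔ T) (hc : T ≤ span ℂ {c} ⊔ U) (hd : U ≤ span ℂ {d}) (x : B) :
    x ∈ span ℂ {a, b, c, d} := by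
  rw [span_insert, span_insert, span_insert]
  exact (ha.trans (sup_le_sup_left (hb.trans (sup_le_sup_left
    (hc.trans (sup_le_sup_left hd _)) _)) _)) mem_top

theorem le_span_sup_of_finrank_le [FiniteDimensional ℂ B] {S T : Submodule ℂ B} {x : B}
    (hST : S ≤ T) (hx : x ∈ T) (hxS : x ∉ S)
    (h : Module.finrank ℂ T ≤ Module.finrank ℂ S + 1) : T ≤ span ℂ {x} ⊔ S := by
  have hlt : S < span ℂ {x} ⊔ S := by
    refine le_sup_right.lt_of_ne fun heq => hxS ?_
    rw [heq]
    exact mem_sup_left (mem_span_singleton_self x)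
  have hle : span ℂ {x} ⊔ S ≤ T := sup_le ((span_singleton_le_iff_mem x T).2 hx) hST
  exact (eq_of_le_of_finrank_le hle (h.trans (finrank_lt_finrank_of_lt hlt))).ge

theorem top_le_span_sup_span_sup [FiniteDimensional ℂ B] (hB : Module.finrank ℂ B = 4)
    {S : Submodule ℂ B} (hS : Module.finrank ℂ S = 2) {a b : B} (hb : b ∉ S) {f : B →ₗ[ℂ] ℂ}
    (hfS : ∀ x ∈ S, f x = 0) (hfb : f b = 0) (hfa : f a ≠ 0) :
    ⊤ ≤ span ℂ {a} ⊔ (span ℂ {b} ⊔ S) := by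
  have hker : span ℂ {b} ⊔ S ≤ LinearMap.ker f :=
    sup_le ((span_singleton_le_iff_mem _ _).2 hfb) hfS
  have hlt : S < span ℂ {b} ⊔ S := by
    refine le_sup_right.lt_of_ne fun heq => hb ?_
    rw [heq]
    exact mem_sup_left (mem_span_singleton_self b)
  have := finrank_lt_finrank_of_lt hlt
  refine le_span_sup_of_finrank_le le_top mem_top (fun ha => hfa (hker ha)) ?_
  rw [finrank_top]
  omega

end Basis

section Structure

variable {B : Type*} [NonUnitalNonAssocRing B] [Module ℂ B] [IsScalarTower ℂ B B]
  [SMulCommClass ℂ B B]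

/-! ### Algebras with one generator -/

theorem hasModel_freeModel (hB : Module.finrank ℂ B = 4) {a u h w : B}
    (hspan : ∀ x, x ∈ span ℂ {a, u, h, w}) (haa : a * a = u) (hua : u * a = h) (hau : a * u = w)
    (huu : u * u = 0) (hh : ∀ x, h * x = 0) (hh' : ∀ x, x * h = 0) (hw : ∀ x, w * x = 0)
    (hw' : ∀ x, x * w = 0) : HasModel B freeModel := by
  obtain ⟨e, he⟩ := exists_equiv_of_span_eq_top hB hspan
  refine ⟨e, fun x y => ?_⟩
  simp only [he, freeModel, add_mul, mul_add, smul_mul_assoc, mul_smul_comm, haa, hua, hau, huu,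
    hh, hh', hw, hw', cons_val]
  module

theorem hasModel_leftModel (hB : Module.finrank ℂ B = 4) {a u h w : B} {α β : ℂ}
    (hspan : ∀ x, x ∈ span ℂ {a, u, h, w}) (haa : a * a = u) (hau : a * u = h)
    (hua : u * a = α • h + β • w) (hah : a * h = w) (hha : h * a = α • w) (huu : u * u = α • w)
    (huh : u * h = 0) (hhu : h * u = 0) (hhh : h * h = 0) (hw : ∀ x, w * x = 0)
    (hw' : ∀ x, x * w = 0) : HasModel B (leftModel α β) := by
  obtain ⟨e, he⟩ := exists_equiv_of_span_eq_top hB hspan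
  refine ⟨e, fun x y => ?_⟩
  simp only [he, leftModel, add_mul, mul_add, smul_mul_assoc, mul_smul_comm, haa, hua, hau, huu,
    hah, hha, huh, hhu, hhh, hw, hw', cons_val]
  module

theorem hasModel_rightModel (hB : Module.finrank ℂ B = 4) {a u h w : B} {ε : ℂ}
    (hspan : ∀ x, x ∈ span ℂ {a, u, h, w}) (haa : a * a = u) (hua : u * a = h)
    (hau : a * u = ε • w) (hha : h * a = w) (hah : a * h = 0) (huu : u * u = 0)
    (huh : u * h = 0) (hhu : h * u = 0) (hhh : h * h = 0) (hw : ∀ x, w * x = 0)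
    (hw' : ∀ x, x * w = 0) : HasModel B (rightModel ε) := by
  obtain ⟨e, he⟩ := exists_equiv_of_span_eq_top hB hspan
  refine ⟨e, fun x y => ?_⟩
  simp only [he, rightModel, add_mul, mul_add, smul_mul_assoc, mul_smul_comm, haa, hua, hau, huu,
    hah, hha, huh, hhu, hhh, hw, hw', cons_val]
  module

/-- If `dim B/B² = 1`, then any `a ∉ B²` generates `B`, and `lowerSeries_succ_le_sup` yields a
basis of products of `a`. The relation `(a(aa))a = (aa)(aa) = a((aa)a)` determines the remaining
products. -/
theorem IsBicommutative.inFamily_of_finrank_three (h : IsBicommutative B)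
    (hn : IsNilpotentAlgebra B) (hB : Module.finrank ℂ B = 4)
    (h₁ : Module.finrank ℂ (lowerSeries B 1) = 3) : InFamily B := by
  have : FiniteDimensional ℂ B := Module.finite_of_finrank_pos (by omega)
  have hlt : ∀ k, lowerSeries B k ≠ ⊥ →
      Module.finrank ℂ (lowerSeries B (k + 1)) < Module.finrank ℂ (lowerSeries B k) :=
    fun k hk => finrank_lt_finrank_of_lt (hn.lowerSeries_lt hk)
  have hne : ∀ {k}, Module.finrank ℂ (lowerSeries B k) ≠ 0 → lowerSeries B k ≠ ⊥ := by
    intro k hk hbot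
    rw [hbot, finrank_bot] at hk
    exact hk rfl
  have h₀ : Module.finrank ℂ (lowerSeries B 0) = 4 := hB ▸ finrank_top ℂ B
  obtain ⟨a, -, ha⟩ := SetLike.exists_of_lt (hn.lowerSeries_lt (hne (k := 0) (by omega)))
  have hC0 : lowerSeries B 0 ≤ span ℂ {a} ⊔ lowerSeries B 1 :=
    le_span_sup_of_finrank_le le_top mem_top ha (by omega)
  have hC1 := h.lowerSeries_succ_le_sup hC0 mem_top hC0
  rw [zero_add, Set.pair_eq_singleton] at hC1
  obtain ⟨u, hu⟩ : ∃ u, a * a = u := ⟨_, rfl⟩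
  rw [hu] at hC1
  have hu1 : u ∈ lowerSeries B 1 := hu ▸ mul_mem_lowerSeries_one a a
  have hC2 := h.lowerSeries_succ_le_sup hC0 hu1 hC1
  have hua2 : u * a ∈ lowerSeries B 2 := mul_mem_lowerSeries hu1 a
  have hau2 : a * u ∈ lowerSeries B 2 := mul_mem_lowerSeries' hu1 a
  have huu3 : u * u ∈ lowerSeries B 3 := h.mul_mem_left hu1 hu1
  by_cases h3 : lowerSeries B 3 = ⊥
  · have hz : ∀ {z}, z ∈ lowerSeries B 3 → z = 0 := fun hz => by rwa [h3, mem_bot] at hz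
    rw [h3, sup_bot_eq, span_insert, sup_comm] at hC2
    exact Or.inr (Or.inr (Or.inr (Or.inr (hasModel_freeModel hB
      (mem_span_of_chain hC0 hC1 hC2 le_rfl) hu rfl rfl (hz huu3)
      (fun x => hz (mul_mem_lowerSeries hua2 x)) (fun x => hz (mul_mem_lowerSeries' hua2 x))
      (fun x => hz (mul_mem_lowerSeries hau2 x)) (fun x => hz (mul_mem_lowerSeries' hau2 x))))))
  -- The dimensions of the lower central series are `4, 3, 2, 1, 0`.
  have hd2 : Module.finrank ℂ (lowerSeries B 2) = 2 := by
    have : Module.finrank ℂ (lowerSeries B 2) < _ := hlt 1 (hne (by omega))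
    have : Module.finrank ℂ (lowerSeries B 1) ≤ _ + Module.finrank ℂ (lowerSeries B 2) :=
      (finrank_mono hC1).trans (finrank_add_le_finrank_add_finrank _ _)
    have : Module.finrank ℂ (span ℂ {u}) ≤ 1 := by simpa using finrank_span_le_card (R := ℂ) {u}
    omega
  have hd3 : Module.finrank ℂ (lowerSeries B 3) = 1 := by
    have : Module.finrank ℂ (lowerSeries B 3) < _ := hlt 2 (hne (by omega))
    have : Module.finrank ℂ (lowerSeries B 3) ≠ 0 := fun h => h3 (finrank_eq_zero.1 h)
    omega
  have hC4 : lowerSeries B 4 = ⊥ := by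
    have : Module.finrank ℂ (lowerSeries B 4) < _ := hlt 3 h3
    exact finrank_eq_zero.1 (by omega)
  have hz : ∀ {z}, z ∈ lowerSeries B 4 → z = 0 := fun hz => by rwa [hC4, mem_bot] at hz
  have hle21 := lowerSeries_succ_le (B := B) 1
  have hle32 := lowerSeries_succ_le (B := B) 2
  have huu : u * u = (a * u) * a := by rw [← hu, h.1]
  have huu' : u * u = a * (u * a) := by rw [← hu, h.2]
  by_cases hx : a * u ∈ lowerSeries B 3
  · -- `a(aa) ∈ C₃`, so `(aa)a` spans `C₂` modulo `C₃`.
    have hx0 : u * u = 0 := huu ▸ hz (mul_mem_lowerSeries hx a)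
    have hy : u * a ∉ lowerSeries B 3 := by
      intro hy
      have : lowerSeries B 2 ≤ lowerSeries B 3 :=
        hC2.trans (sup_le (span_le.2 (by rintro z (rfl | rfl) <;> assumption)) le_rfl)
      have := finrank_mono this
      omega
    have hC2' : lowerSeries B 2 ≤ span ℂ {u * a} ⊔ lowerSeries B 3 :=
      le_span_sup_of_finrank_le hle32 hua2 hy (by omega)
    have hC3 := h.lowerSeries_succ_le_sup hC0 hua2 hC2'
    rw [hC4, sup_bot_eq, ← huu', hx0, span_insert_zero] at hC3
    have hw3 : u * a * a ∈ lowerSeries B 3 := mul_mem_lowerSeries hua2 a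
    obtain ⟨ε, hε⟩ := mem_span_singleton.1 (hC3 hx)
    exact Or.inr (Or.inr (Or.inr (Or.inl ⟨ε, hasModel_rightModel hB
      (mem_span_of_chain hC0 hC1 hC2' hC3) hu rfl hε.symm rfl (huu' ▸ hx0) hx0
      (hz (h.mul_mem_left hu1 hua2)) (hz (h.mul_mem_right hu1 hua2))
      (hz (h.mul_mem_left (hle21 hua2) hua2)) (fun x => hz (mul_mem_lowerSeries hw3 x))
      (fun x => hz (mul_mem_lowerSeries' hw3 x))⟩)))
  · have hC2' : lowerSeries B 2 ≤ span ℂ {a * u} ⊔ lowerSeries B 3 :=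
      le_span_sup_of_finrank_le hle32 hau2 hx (by omega)
    have hC3 := h.lowerSeries_succ_le_sup hC0 hau2 hC2'
    obtain ⟨v, hv, c, hc, hvc⟩ := mem_sup.1 (hC2' hua2)
    obtain ⟨α, rfl⟩ := mem_span_singleton.1 hv
    -- `(a(aa))a = a((aa)a)` is a multiple of `a(a(aa))`, which therefore spans `C₃`.
    have hxa : (a * u) * a = α • (a * (a * u)) := by
      rw [← huu, huu', ← hvc, mul_add, mul_smul_comm, hz (mul_mem_lowerSeries' hc a), add_zero]
    have hw3 : a * (a * u) ∈ lowerSeries B 3 := mul_mem_lowerSeries' hau2 a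
    rw [hC4, sup_bot_eq, hxa] at hC3
    replace hC3 : lowerSeries B 3 ≤ span ℂ {a * (a * u)} := by
      refine hC3.trans (span_le.2 ?_)
      rintro z (rfl | rfl)
      · exact mem_span_singleton_self _
      · exact smul_mem _ _ (mem_span_singleton_self _)
    obtain ⟨β, rfl⟩ := mem_span_singleton.1 (hC3 hc)
    exact Or.inr (Or.inr (Or.inl ⟨α, β, hasModel_leftModel hB
      (mem_span_of_chain hC0 hC1 hC2' hC3) hu rfl hvc.symm rfl hxa (huu.trans hxa)
      (hz (h.mul_mem_left hu1 hau2)) (hz (h.mul_mem_right hu1 hau2))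
      (hz (h.mul_mem_left (hle21 hau2) hau2)) (fun x => hz (mul_mem_lowerSeries hw3 x))
      (fun x => hz (mul_mem_lowerSeries' hw3 x))⟩))

/-! ### Algebras with two generators -/

theorem hasModel_symModel (hB : Module.finrank ℂ B = 4) {a u b w : B} {l r p q s : ℂ}
    (hspan : ∀ x, x ∈ span ℂ {a, u, b, w}) (haa : a * a = u) (hau : a * u = l • w)
    (hua : u * a = r • w) (hab : a * b = p • w) (hba : b * a = q • w) (hbb : b * b = s • w)
    (huu : u * u = 0) (hub : u * b = 0) (hbu : b * u = 0) (hw : ∀ x, w * x = 0)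
    (hw' : ∀ x, x * w = 0) : HasModel B (symModel l r p q s) := by
  obtain ⟨e, he⟩ := exists_equiv_of_span_eq_top hB hspan
  refine ⟨e, fun x y => ?_⟩
  simp only [he, symModel, add_mul, mul_add, smul_mul_assoc, mul_smul_comm, haa, hua, hau, huu,
    hab, hba, hbb, hub, hbu, hw, hw', cons_val]
  module

theorem hasModel_asymModel (hB : Module.finrank ℂ B = 4) {a b u w : B} {l r p q s : ℂ}
    (hspan : ∀ x, x ∈ span ℂ {a, b, u, w}) (hab : a * b = u) (hau : a * u = l • w)
    (hub : u * b = r • w) (haa : a * a = p • w) (hba : b * a = q • w) (hbb : b * b = s • w)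
    (huu : u * u = 0) (hua : u * a = 0) (hbu : b * u = 0) (hw : ∀ x, w * x = 0)
    (hw' : ∀ x, x * w = 0) : HasModel B (asymModel l r p q s) := by
  obtain ⟨e, he⟩ := exists_equiv_of_span_eq_top hB hspan
  refine ⟨e, fun x y => ?_⟩
  simp only [he, asymModel, add_mul, mul_add, smul_mul_assoc, mul_smul_comm, haa, hua, hau, huu,
    hab, hba, hbb, hub, hbu, hw, hw', cons_val]
  module

/-- Here `V` stands for `B/B²`, the form `b` for the product with values in the line `B²/C₂`, and
`l`, `r` for the left and right actions of `V` on this line. The identities which bicommutativity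
imposes on them force `b` to be of rank one, with `l` and `r` proportional to its two factors. -/
theorem exists_eq_mul_of_comm {V : Type*} [AddCommGroup V] [Module ℂ V]
    (b : V →ₗ[ℂ] V →ₗ[ℂ] ℂ) (l r : V →ₗ[ℂ] ℂ) (hb : ∃ x y, b x y ≠ 0)
    (hlr : ∃ x, l x ≠ 0 ∨ r x ≠ 0) (hr : ∀ x y z, b x y * r z = b x z * r y)
    (hl : ∀ x y z, l x * b y z = l y * b x z) :
    ∃ (F G : V →ₗ[ℂ] ℂ) (l₀ r₀ : ℂ), (l₀ ≠ 0 ∨ r₀ ≠ 0) ∧ (∀ x y, b x y = F x * G y) ∧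
      (∀ x, l x = l₀ * F x) ∧ (∀ x, r x = r₀ * G x) := by
  obtain ⟨x₁, y₁, hb⟩ := hb
  by_cases hr0 : ∃ z, r z ≠ 0
  · obtain ⟨z, hz⟩ := hr0
    have hFG : ∀ x y, b x y = (r z)⁻¹ * b x z * r y := fun x y => by
      field_simp
      exact hr x y z
    have hx₁ : b x₁ z ≠ 0 := fun h => hb (by rw [hFG, h]; simp)
    refine ⟨(r z)⁻¹ • b.flip z, r, l x₁ * r z / b x₁ z, 1, Or.inr one_ne_zero,
      fun x y => by simpa using hFG x y, fun x => ?_, fun x => by simp⟩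
    simp only [LinearMap.smul_apply, LinearMap.flip_apply, smul_eq_mul]
    field_simp
    exact hl x x₁ z
  · push Not at hr0
    obtain ⟨x, hx⟩ : ∃ x, l x ≠ 0 := by simpa [hr0] using hlr
    refine ⟨l, (l x)⁻¹ • b x, 1, 0, Or.inl one_ne_zero, fun y z => ?_, fun y => by simp,
      fun y => by simp [hr0]⟩
    simp only [LinearMap.smul_apply, smul_eq_mul]
    field_simp
    rw [mul_comm, hl x y z]

/-- If `dim B/B² = 2`, then `B² = ⟨u, v⟩` with `v` spanning `C₂`, and the algebra is described by
a form `b` on `B/B²` with `xy ≡ b(x, y) u` modulo `v`, and functionals with `xu = l(x) v` and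
`ux = r(x) v`. By bicommutativity `b(x, y) = F(x) G(y)`, with `l` proportional to `F` and `r`
to `G`. The two cases are those of `F` and `G` proportional and independent. -/
theorem IsBicommutative.inFamily_of_finrank_two (h : IsBicommutative B)
    (hn : IsNilpotentAlgebra B) (hp : IsPure B) (hB : Module.finrank ℂ B = 4)
    (h₁ : Module.finrank ℂ (lowerSeries B 1) = 2) : InFamily B := by
  have : FiniteDimensional ℂ B := Module.finite_of_finrank_pos (by omega)
  have hC2 := hp.lowerSeries_two_ne_bot
  have hC1 : lowerSeries B 1 ≠ ⊥ := fun h => hC2 (le_bot_iff.1 (h ▸ lowerSeries_succ_le 1))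
  have h21 : lowerSeries B 2 < lowerSeries B 1 := hn.lowerSeries_lt hC1
  have hd2 : Module.finrank ℂ (lowerSeries B 2) = 1 := by
    have := finrank_lt_finrank_of_lt h21
    have : Module.finrank ℂ (lowerSeries B 2) ≠ 0 := fun h => hC2 (finrank_eq_zero.1 h)
    omega
  have hC3 : lowerSeries B 3 = ⊥ := by
    have : Module.finrank ℂ (lowerSeries B 3) < _ :=
      finrank_lt_finrank_of_lt (hn.lowerSeries_lt hC2)
    exact finrank_eq_zero.1 (by omega)
  have hz : ∀ {z}, z ∈ lowerSeries B 3 → z = 0 := fun hz => by rwa [hC3, mem_bot] at hz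
  obtain ⟨v, hv, hv0⟩ := exists_mem_ne_zero_of_ne_bot hC2
  have hC2v : lowerSeries B 2 ≤ span ℂ {v} := by
    have := le_span_sup_of_finrank_le (S := ⊥) bot_le hv (by simpa using hv0)
      (by rw [hd2, finrank_bot])
    rwa [sup_bot_eq] at this
  obtain ⟨u, hu, hu2⟩ := SetLike.exists_of_lt h21
  have hsup : ∀ {x}, x ∈ lowerSeries B 1 → x ∉ lowerSeries B 2 →
      lowerSeries B 1 ≤ span ℂ {x} ⊔ lowerSeries B 2 :=
    fun hx hx2 => le_span_sup_of_finrank_le h21.le hx hx2 (by omega)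
  -- The functional `ψ` reads off the coefficient of `u` modulo `C₂`, and `φ` that of `v`.
  obtain ⟨ψ, hψu, hψ⟩ : ∃ ψ : B →ₗ[ℂ] ℂ, ψ u = 1 ∧ ∀ x ∈ lowerSeries B 2, ψ x = 0 := by
    obtain ⟨f, hf, hf'⟩ := exists_le_ker_of_notMem hu2
    exact ⟨(f u)⁻¹ • f, by simp [hf], fun x hx => by simp [LinearMap.mem_ker.1 (hf' hx)]⟩
  obtain ⟨φ, hφv⟩ : ∃ φ : B →ₗ[ℂ] ℂ, φ v = 1 := by
    obtain ⟨f, hf, -⟩ := exists_le_ker_of_notMem (p := (⊥ : Submodule ℂ B)) (by simpa using hv0)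
    exact ⟨(f v)⁻¹ • f, by simp [hf]⟩
  have hnot : ¬ ∀ x y : B, x * y ∈ lowerSeries B 2 := by
    refine fun hb => h21.not_ge (span_le.2 ?_)
    rintro z ⟨x, -, y, rfl | rfl⟩
    · exact hb x y
    · exact hb y x
  have hφ : ∀ x ∈ lowerSeries B 2, x = φ x • v := by
    intro x hx
    obtain ⟨t, rfl⟩ := mem_span_singleton.1 (hC2v hx)
    simp [hφv]
  have hmul : ∀ x ∈ lowerSeries B 1, ∃ c ∈ lowerSeries B 2, x = ψ x • u + c := by
    intro x hx
    obtain ⟨y, hy, c, hc, rfl⟩ := mem_sup.1 (hsup hu hu2 hx)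
    obtain ⟨t, rfl⟩ := mem_span_singleton.1 hy
    exact ⟨c, hc, by simp [hψu, hψ c hc]⟩
  have hmulr : ∀ x ∈ lowerSeries B 1, ∀ y, x * y = ψ x • (u * y) := by
    intro x hx y
    obtain ⟨c, hc, hxc⟩ := hmul x hx
    conv_lhs => rw [hxc, add_mul, smul_mul_assoc, hz (mul_mem_lowerSeries hc y), add_zero]
  have hmull : ∀ x ∈ lowerSeries B 1, ∀ y, y * x = ψ x • (y * u) := by
    intro x hx y
    obtain ⟨c, hc, hxc⟩ := hmul x hx
    conv_lhs => rw [hxc, mul_add, mul_smul_comm, hz (mul_mem_lowerSeries' hc y), add_zero]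
  have huy : ∀ y, u * y = φ (u * y) • v := fun y => hφ _ (mul_mem_lowerSeries hu y)
  have hyu : ∀ y, y * u = φ (y * u) • v := fun y => hφ _ (mul_mem_lowerSeries' hu y)
  obtain ⟨F, G, l, r, hlr, hFG, hl, hr⟩ := exists_eq_mul_of_comm
    ((LinearMap.mul ℂ B).compr₂ ψ) (φ ∘ₗ LinearMap.mulRight ℂ u) (φ ∘ₗ LinearMap.mulLeft ℂ u)
    (by
      by_contra! hb
      refine hnot fun x y => ?_
      obtain ⟨c, hc, hxy⟩ := hmul _ (mul_mem_lowerSeries_one x y)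
      have : ψ (x * y) = 0 := hb x y
      rwa [hxy, this, zero_smul, zero_add])
    (by
      by_contra! hb
      refine hp fun x y z => ⟨?_, ?_⟩
      · have : φ (u * z) = 0 := (hb z).2
        rw [hmulr _ (mul_mem_lowerSeries_one x y), huy, this, zero_smul, smul_zero]
      · have : φ (x * u) = 0 := (hb x).1
        rw [hmull _ (mul_mem_lowerSeries_one y z), hyu, this, zero_smul, smul_zero])
    (fun x y z => by
      have := congrArg φ (h.1 x y z)
      rw [hmulr _ (mul_mem_lowerSeries_one x y), hmulr _ (mul_mem_lowerSeries_one x z)] at this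
      simpa using this)
    (fun x y z => by
      have := congrArg φ (h.2 x y z)
      rw [hmull _ (mul_mem_lowerSeries_one y z), hmull _ (mul_mem_lowerSeries_one x z)] at this
      simpa [mul_comm] using this)
  replace hFG : ∀ x y, ψ (x * y) = F x * G y := hFG
  replace hl : ∀ x, x * u = (l * F x) • v := fun x => by
    rw [hyu, ← hl]
    rfl
  replace hr : ∀ x, u * x = (r * G x) • v := fun x => by
    rw [huy, ← hr]
    rfl
  have hv' : ∀ x, v * x = 0 := fun x => hz (mul_mem_lowerSeries hv x)
  have hv'' : ∀ x, x * v = 0 := fun x => hz (mul_mem_lowerSeries' hv x)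
  have hzero : ∀ x y, F x * G y = 0 → ∃ t : ℂ, x * y = t • v := by
    intro x y hxy
    obtain ⟨c, hc, hxc⟩ := hmul _ (mul_mem_lowerSeries_one x y)
    rw [hFG, hxy, zero_smul, zero_add] at hxc
    exact ⟨φ c, hxc.trans (hφ c hc)⟩
  obtain ⟨x₁, y₁, hxy₁⟩ : ∃ x y, F x * G y ≠ 0 := by
    by_contra! hb
    refine hnot fun x y => ?_
    obtain ⟨t, ht⟩ := hzero x y (hb x y)
    exact ht ▸ smul_mem _ t hv
  have hx₁ : F x₁ ≠ 0 := left_ne_zero_of_mul hxy₁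
  have hy₁ : G y₁ ≠ 0 := right_ne_zero_of_mul hxy₁
  have hF : ∀ x ∈ lowerSeries B 1, F x = 0 := by
    intro x hx
    have := (hFG x y₁).symm.trans (hψ _ (mul_mem_lowerSeries hx y₁))
    simpa [hy₁] using this
  have hG : ∀ x ∈ lowerSeries B 1, G x = 0 := by
    intro x hx
    have := (hFG x₁ x).symm.trans (hψ _ (mul_mem_lowerSeries' hx x₁))
    simpa [hx₁] using this
  have hprod : ∀ {a b : B}, F a ≠ 0 → G b ≠ 0 →
      lowerSeries B 1 ≤ span ℂ {a * b} ⊔ lowerSeries B 2 := by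
    intro a b ha hb
    refine hsup (mul_mem_lowerSeries_one a b) fun hab => mul_ne_zero ha hb ?_
    rw [← hFG, hψ _ hab]
  by_cases hker : LinearMap.ker F ≤ LinearMap.ker G
  · -- `F` and `G` are proportional: the basis is `x₁`, `x₁ x₁`, `b ∈ ker F`, `v`.
    have ha : G x₁ ≠ 0 := by
      intro h0
      refine hy₁ ?_
      have hy : y₁ - (F y₁ / F x₁) • x₁ ∈ LinearMap.ker F := by simp [hx₁]
      simpa [h0] using hker hy
    obtain ⟨b, hbF, hb⟩ : ∃ b ∈ LinearMap.ker F, b ∉ lowerSeries B 1 := by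
      by_contra! hle
      have h₂ := finrank_mono (show LinearMap.ker F ≤ lowerSeries B 1 from hle)
      have h₃ := F.finrank_range_add_finrank_ker
      have h₄ := (LinearMap.range F).finrank_le
      rw [Module.finrank_self] at h₄
      omega
    have hbG : G b = 0 := hker hbF
    replace hbF : F b = 0 := hbF
    obtain ⟨p, hp⟩ := hzero x₁ b (by rw [hbG, mul_zero])
    obtain ⟨q, hq⟩ := hzero b x₁ (by rw [hbF, zero_mul])
    obtain ⟨s, hs⟩ := hzero b b (by rw [hbF, zero_mul])
    have haa := mul_mem_lowerSeries_one x₁ x₁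
    have hspan := mem_span_of_chain (top_le_span_sup_span_sup hB h₁ hb hF hbF hx₁) le_rfl
      (hprod hx₁ ha) hC2v
    refine Or.inl ⟨F x₁ * G x₁ * (l * F x₁), F x₁ * G x₁ * (r * G x₁), p, q, s, ?_,
      hasModel_symModel hB (a := x₁) (b := b) (w := v) (fun x => ?_) rfl ?_ ?_ hp hq hs ?_ ?_ ?_
      hv' hv''⟩
    · simpa [hx₁, ha] using hlr
    · rw [Set.insert_comm (x₁ * x₁)]
      exact hspan x
    · rw [hmull _ haa, hl, hFG, smul_smul]
    · rw [hmulr _ haa, hr, hFG, smul_smul]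
    · rw [hmull _ haa, hl, hF _ haa, mul_zero, zero_smul, smul_zero]
    · rw [hmulr _ haa, hr, hbG, mul_zero, zero_smul, smul_zero]
    · rw [hmull _ haa, hl, hbF, mul_zero, zero_smul, smul_zero]
  · -- `F` and `G` are independent: the basis is `a ∈ ker G`, `b ∈ ker F`, `ab`, `v`.
    obtain ⟨b, hbF, hbG⟩ := SetLike.not_le_iff_exists.1 hker
    replace hbF : F b = 0 := hbF
    replace hbG : G b ≠ 0 := hbG
    obtain ⟨a, haF, haG⟩ : ∃ a, F a ≠ 0 ∧ G a = 0 :=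
      ⟨x₁ - (G x₁ / G b) • b, by simp [hbF, hx₁], by simp [hbG]⟩
    have hb : b ∉ lowerSeries B 1 := fun hb => hbG (hG b hb)
    obtain ⟨p, hp⟩ := hzero a a (by rw [haG, mul_zero])
    obtain ⟨q, hq⟩ := hzero b a (by rw [haG, mul_zero])
    obtain ⟨s, hs⟩ := hzero b b (by rw [hbF, zero_mul])
    have hab := mul_mem_lowerSeries_one a b
    refine Or.inr (Or.inl ⟨F a * G b * (l * F a), F a * G b * (r * G b), p, q, s, ?_,
      hasModel_asymModel hB (a := a) (b := b) (w := v)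
      (mem_span_of_chain (top_le_span_sup_span_sup hB h₁ hb hF hbF haF) le_rfl
        (hprod haF hbG) hC2v) rfl ?_ ?_ hp hq hs ?_ ?_ ?_ hv' hv''⟩)
    · simpa [haF, hbG] using hlr
    · rw [hmull _ hab, hl, hFG, smul_smul]
    · rw [hmulr _ hab, hr, hFG, smul_smul]
    · rw [hmull _ hab, hl, hF _ hab, mul_zero, zero_smul, smul_zero]
    · rw [hmulr _ hab, hr, haG, mul_zero, zero_smul, smul_zero]
    · rw [hmull _ hab, hl, hbF, mul_zero, zero_smul, smul_zero]

/-- Since `C₂ ≠ 0`, the dimension of `C₁ = B²` is `2` or `3`. -/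
theorem IsBicommutative.inFamily (h : IsBicommutative B) (hn : IsNilpotentAlgebra B)
    (hp : IsPure B) (hB : Module.finrank ℂ B = 4) : InFamily B := by
  have : FiniteDimensional ℂ B := Module.finite_of_finrank_pos (by omega)
  have h0 : Module.finrank ℂ (lowerSeries B 0) = 4 := hB ▸ finrank_top ℂ B
  have hlt : ∀ k, lowerSeries B k ≠ ⊥ →
      Module.finrank ℂ (lowerSeries B (k + 1)) < Module.finrank ℂ (lowerSeries B k) :=
    fun k hk => finrank_lt_finrank_of_lt (hn.lowerSeries_lt hk)
  have hC2 := hp.lowerSeries_two_ne_bot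
  have hC1 : lowerSeries B 1 ≠ ⊥ := fun h => hC2 (le_bot_iff.1 (h ▸ lowerSeries_succ_le 1))
  have hC0 : lowerSeries B 0 ≠ ⊥ := fun h => hC1 (le_bot_iff.1 (h ▸ lowerSeries_succ_le 0))
  have h1 : Module.finrank ℂ (lowerSeries B 1) < _ := hlt 0 hC0
  have h2 : Module.finrank ℂ (lowerSeries B 2) < _ := hlt 1 hC1
  have h2' : Module.finrank ℂ (lowerSeries B 2) ≠ 0 := fun h => hC2 (finrank_eq_zero.1 h)
  obtain h1 | h1 : Module.finrank ℂ (lowerSeries B 1) = 2 ∨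
      Module.finrank ℂ (lowerSeries B 1) = 3 := by omega
  · exact h.inFamily_of_finrank_two hn hp hB h1
  · exact h.inFamily_of_finrank_three hn hB h1

end Structure

end Bicomm

theorem mainTheorem1 (B : Type*) [NonUnitalNonAssocRing B] [Module ℂ B]
    [IsScalarTower ℂ B B] [SMulCommClass ℂ B B] :
    (Module.finrank ℂ B = 4 ∧ Bicomm.IsBicommutative B ∧ Bicomm.IsNilpotentAlgebra B ∧
        Bicomm.IsPure B) ↔
      ∃ T : Bicomm.TableA, Bicomm.AlgIsomorphic B T.Alg := by
  constructor
  · rintro ⟨hB, h, hn, hp⟩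
    obtain ⟨T, hT⟩ := (h.inFamily hn hp hB).exists_label
    exact ⟨T, T.algIsomorphic_iff.2 hT⟩
  · rintro ⟨T, hT⟩
    exact (Bicomm.inFamily_of_hasModel (T.algIsomorphic_iff.1 hT)).isNilpotentPureBicommutative
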